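/- Let $m \ge 3$ and let $\mathbb{CP}^m$ be the complex projective space, regarded as a real smooth manifold of dimension $2m$ and endowed with the Fubini–Study metric $g_{FS}$ of constant holomorphic sectional curvature $c>0$, that is, the Riemannian metric whose pull-back by the projection $\mathbb{C}^{m+1}\setminus\{0\}\to\mathbb{CP}^m$ is $$(\xi,\eta)\longmapsto \frac{4}{c}\,\mathrm{Re}\left(\frac{\langle \xi,\eta\rangle}{|z|^2}-\frac{\langle \xi,z\rangle\langle z,\eta\rangle}{|z|^4}\right)$$ at the point $z$, where $\langle\cdot,\cdot\rangle$ is the standard Hermitian product. A system of smooth local coordinates $x_1,\dots,x_{2m}$ on an open set $\mathcal{U}$ is called orthogonal if $g_{FS}\big(\tfrac{\partial}{\partial x_i},\tfrac{\partial}{\partial x_j}\big)=0$ on $\mathcal{U}$ whenever $i\ne j$. Then $(\mathbb{CP}^m,g_{FS})$ admits no local orthogonal coordinates: there is no nonempty open subset $\mathcal{U}\subset\mathbb{CP}^m$ on which there exists an orthogonal system of coordinates. -/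

import Mathlib

open scoped Manifold ContDiff LinearAlgebra.Projectivization

noncomputable section

namespace OrthCoord

/-! ### Orthogonal coordinates on a Riemannian manifold -/

section Riemannian

variable {E : Type*} [NormedAddCommGroup E] [NormedSpace ℝ E]
  {M : Type*} [TopologicalSpace M] [ChartedSpace E M]

/-- A system of local coordinates `x = (x₁, …, xₙ)` on `M`: a smooth diffeomorphism from an open
subset `x.source` of `M` onto an open subset of `ℝⁿ`. -/
abbrev LocalCoordinates (E : Type*) [NormedAddCommGroup E] [NormedSpace ℝ E]
    (M : Type*) [TopologicalSpace M] [ChartedSpace E M] (n : ℕ) :=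
  PartialDiffeomorph 𝓘(ℝ, E) 𝓘(ℝ, EuclideanSpace ℝ (Fin n)) M (EuclideanSpace ℝ (Fin n)) ∞

/-- The coordinate vector field `∂/∂xᵢ` at the point `p`. Only its values at `p ∈ x.source`
are meaningful. -/
def LocalCoordinates.partialAt {n : ℕ} (x : LocalCoordinates E M n) (i : Fin n) (p : M) :
    TangentSpace 𝓘(ℝ, E) p :=
  mfderiv 𝓘(ℝ, EuclideanSpace ℝ (Fin n)) 𝓘(ℝ, E) x.symm (x p) (EuclideanSpace.single i (1 : ℝ))

/-- The coordinates `x` are orthogonal for the Riemannian metric `g` if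
`g (∂/∂xᵢ, ∂/∂xⱼ) = 0` on the coordinate domain whenever `i ≠ j`. -/
def IsOrthogonal [IsManifold 𝓘(ℝ, E) ∞ M]
    (g : Bundle.ContMDiffRiemannianMetric 𝓘(ℝ, E) ∞ E (fun p : M ↦ TangentSpace 𝓘(ℝ, E) p))
    {n : ℕ} (x : LocalCoordinates E M n) : Prop :=
  ∀ p ∈ x.source, ∀ i j : Fin n, i ≠ j → g.inner p (x.partialAt i p) (x.partialAt j p) = 0

end Riemannian

/-! ### Complex projective space as a smooth manifold -/

/-- The space `ℂᵐ⁺¹` of homogeneous coordinates, with its standard Hermitian product. -/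
abbrev Homog (m : ℕ) : Type := EuclideanSpace ℂ (Fin (m + 1))

/-- Complex projective space `ℂℙᵐ`: the complex lines through the origin of `ℂᵐ⁺¹`. -/
abbrev CP (m : ℕ) : Type := ℙ ℂ (Homog m)

variable {m : ℕ}

/-- The quotient topology. -/
instance : TopologicalSpace (CP m) :=
  inferInstanceAs (TopologicalSpace (Quotient (projectivizationSetoid ℂ (Homog m))))

/-- The affine coordinates `(z_k / z_i)_{k ≠ i}` of a vector `z`. -/
def affineCoord (i : Fin (m + 1)) (z : Homog m) : Fin m → ℂ :=
  fun k ↦ z (i.succAbove k) / z i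

/-- The linear map `ℂᵐ → ℂᵐ⁺¹` that inserts `0` at position `i`. -/
def insertZero (i : Fin (m + 1)) : (Fin m → ℂ) →L[ℝ] Homog m :=
  LinearMap.toContinuousLinearMap
    { toFun := fun w ↦ WithLp.toLp 2 (i.insertNth (α := fun _ ↦ ℂ) 0 w)
      map_add' := by
        intro u v
        ext k
        refine Fin.succAboveCases i ?_ (fun l ↦ ?_) k <;> simp
      map_smul' := by
        intro a u
        ext k
        refine Fin.succAboveCases i ?_ (fun l ↦ ?_) k <;> simp }

@[simp] lemma insertZero_same (i : Fin (m + 1)) (w : Fin m → ℂ) : insertZero i w i = 0 := by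
  simp [insertZero]

@[simp] lemma insertZero_succAbove (i : Fin (m + 1)) (w : Fin m → ℂ) (k : Fin m) :
    insertZero i w (i.succAbove k) = w k := by
  simp [insertZero]

/-- The vector of `ℂᵐ⁺¹` with `1` at position `i` and the other entries given by `w`. -/
def insertOne (i : Fin (m + 1)) (w : Fin m → ℂ) : Homog m :=
  insertZero i w + EuclideanSpace.single i 1

@[simp] lemma insertOne_same (i : Fin (m + 1)) (w : Fin m → ℂ) : insertOne i w i = 1 := by
  simp [insertOne]

@[simp] lemma insertOne_succAbove (i : Fin (m + 1)) (w : Fin m → ℂ) (k : Fin m) :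
    insertOne i w (i.succAbove k) = w k := by
  simp [insertOne]

lemma insertOne_ne_zero (i : Fin (m + 1)) (w : Fin m → ℂ) : insertOne i w ≠ 0 := by
  intro h
  have := insertOne_same i w
  simp [h] at this

lemma contDiff_insertOne {n : ℕ∞ω} (i : Fin (m + 1)) :
    ContDiff ℝ n (insertOne (m := m) i) :=
  (insertZero i).contDiff.add contDiff_const

lemma contDiff_coord {n : ℕ∞ω} (i : Fin (m + 1)) :
    ContDiff ℝ n (fun z : Homog m ↦ z i) :=
  ((EuclideanSpace.proj (𝕜 := ℂ) i).restrictScalars ℝ).contDiff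

lemma contDiffAt_affineCoord {n : ℕ∞ω} (i : Fin (m + 1)) {z : Homog m} (hz : z i ≠ 0) :
    ContDiffAt ℝ n (affineCoord (m := m) i) z :=
  contDiffAt_pi.2 fun k ↦ by
    simp only [affineCoord, div_eq_mul_inv]
    exact (contDiff_coord (i.succAbove k)).contDiffAt.mul ((contDiff_coord i).contDiffAt.inv hz)

lemma insertOne_affineCoord (i : Fin (m + 1)) {z : Homog m} (hz : z i ≠ 0) :
    insertOne i (affineCoord i z) = (z i)⁻¹ • z := by
  ext k
  refine Fin.succAboveCases i ?_ (fun l ↦ ?_) k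
  · simp [hz]
  · simp [affineCoord, div_eq_inv_mul]

lemma affineCoord_insertOne (i : Fin (m + 1)) (w : Fin m → ℂ) :
    affineCoord i (insertOne i w) = w := by
  ext k
  simp [affineCoord]

lemma continuous_mk' : Continuous (Projectivization.mk' ℂ (V := Homog m)) := continuous_quotient_mk'

lemma isQuotientMap_mk' : Topology.IsQuotientMap (Projectivization.mk' ℂ (V := Homog m)) :=
  isQuotientMap_quotient_mk'

/-- The set of points of `ℂℙᵐ` whose `i`-th homogeneous coordinate does not vanish. -/
def affineDomain (i : Fin (m + 1)) : Set (CP m) :=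
  {p | Projectivization.lift (fun z ↦ (z : Homog m) i ≠ 0) (by
    rintro ⟨a, ha⟩ ⟨b, hb⟩ t h
    obtain rfl : a = t • b := h
    have ht : t ≠ 0 := by rintro rfl; simp at ha
    simp [ht]) p}

lemma isOpen_affineDomain (i : Fin (m + 1)) : IsOpen (affineDomain (m := m) i) := by
  rw [← isQuotientMap_mk'.isOpen_preimage]
  exact isOpen_ne_fun ((contDiff_coord (n := 0) i).continuous.comp continuous_subtype_val)
    continuous_const

/-- The affine chart `[z] ↦ (z_k / z_i)_{k ≠ i}` of `ℂℙᵐ` on the open set `z_i ≠ 0`. -/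
def affineChart (i : Fin (m + 1)) : OpenPartialHomeomorph (CP m) (Fin m → ℂ) where
  toFun := Projectivization.lift (fun z ↦ affineCoord i (z : Homog m)) (by
    rintro ⟨a, ha⟩ ⟨b, hb⟩ t h
    obtain rfl : a = t • b := h
    have ht : t ≠ 0 := by rintro rfl; simp at ha
    ext k
    simp [affineCoord, mul_div_mul_left _ _ ht])
  invFun w := Projectivization.mk ℂ (insertOne i w) (insertOne_ne_zero i w)
  source := affineDomain i
  target := Set.univ
  map_source' _ _ := Set.mem_univ _
  map_target' w _ := by simp [affineDomain]
  left_inv' p := by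
    refine Projectivization.ind (fun z hz hp ↦ ?_) p
    have hzi : z i ≠ 0 := hp
    rw [Projectivization.lift_mk, Projectivization.mk_eq_mk_iff']
    exact ⟨(z i)⁻¹, (insertOne_affineCoord i hzi).symm⟩
  right_inv' w _ := affineCoord_insertOne i w
  open_source := isOpen_affineDomain i
  open_target := isOpen_univ
  continuousOn_toFun := by
    rw [isQuotientMap_mk'.continuousOn_isOpen_iff (isOpen_affineDomain i)]
    intro z hz
    have hzi : (z : Homog m) i ≠ 0 := hz
    exact ((contDiffAt_affineCoord (n := 0) i hzi).continuousAt.comp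
      continuous_subtype_val.continuousAt).continuousWithinAt
  continuousOn_invFun := by
    have h : Continuous (fun w ↦ (⟨insertOne i w, insertOne_ne_zero i w⟩ :
        {v : Homog m // v ≠ 0})) := (contDiff_insertOne (n := 0) i).continuous.subtype_mk _
    exact (continuous_mk'.comp h).continuousOn

lemma affineChart_mk (i : Fin (m + 1)) (z : Homog m) (hz : z ≠ 0) :
    affineChart i (Projectivization.mk ℂ z hz) = affineCoord i z := rfl

lemma affineChart_symm (i : Fin (m + 1)) (w : Fin m → ℂ) :
    (affineChart i).symm w = Projectivization.mk ℂ (insertOne i w) (insertOne_ne_zero i w) := rfl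

lemma mk_mem_affineChart_source (i : Fin (m + 1)) (z : Homog m) (hz : z ≠ 0) :
    Projectivization.mk ℂ z hz ∈ (affineChart i).source ↔ z i ≠ 0 := Iff.rfl

lemma exists_mem_affineChart_source (p : CP m) : ∃ i, p ∈ (affineChart i).source := by
  refine Projectivization.ind (fun z hz ↦ ?_) p
  by_contra! h
  refine hz (PiLp.ext fun i ↦ ?_)
  simpa [mk_mem_affineChart_source] using h i

/-- An index `i` such that the `i`-th homogeneous coordinate does not vanish at `p`. -/
def chartIdx (p : CP m) : Fin (m + 1) := (exists_mem_affineChart_source p).choose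

lemma mem_chartIdx_source (p : CP m) : p ∈ (affineChart (chartIdx p)).source :=
  (exists_mem_affineChart_source p).choose_spec

/-- The atlas of `ℂℙᵐ` made of the affine charts. -/
instance : ChartedSpace (Fin m → ℂ) (CP m) where
  atlas := Set.range affineChart
  chartAt p := affineChart (chartIdx p)
  mem_chart_source := mem_chartIdx_source
  chart_mem_atlas _ := Set.mem_range_self _

lemma chartAt_eq (p : CP m) : chartAt (Fin m → ℂ) p = affineChart (chartIdx p) := rfl

instance : IsManifold 𝓘(ℝ, Fin m → ℂ) ω (CP m) := by
  refine isManifold_of_contDiffOn _ _ _ ?_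
  rintro _ _ ⟨i, rfl⟩ ⟨j, rfl⟩ w hw
  have hw' : insertOne i w j ≠ 0 := hw.1.2
  exact ((contDiffAt_affineCoord j hw').comp w (contDiff_insertOne i).contDiffAt).contDiffWithinAt

/-! ### The Fubini–Study metric -/

/-- The real symmetric form on `ℂᵐ⁺¹`, attached to a nonzero vector `z`,
`(ξ, η) ↦ Re (⟪ξ, η⟫ / ‖z‖² - ⟪ξ, z⟫ ⟪z, η⟫ / ‖z‖⁴)`. It is the pull-back of the Fubini–Study
metric of holomorphic sectional curvature `4` by `z ↦ [z]`. -/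
def fsForm (z : Homog m) : Homog m →L[ℝ] Homog m →L[ℝ] ℝ :=
  LinearMap.toContinuousBilinearMap <| LinearMap.mk₂ ℝ
    (fun ξ η ↦ (inner ℂ ξ η / (‖z‖ : ℂ) ^ 2 - inner ℂ ξ z * inner ℂ z η / (‖z‖ : ℂ) ^ 4).re)
    (fun ξ ξ' η ↦ by rw [← Complex.add_re]; congr 1; simp only [inner_add_left]; ring)
    (fun a ξ η ↦ by
      rw [smul_eq_mul, ← Complex.re_ofReal_mul]; congr 1
      simp only [inner_smul_left_eq_smul, Complex.real_smul]; ring)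
    (fun ξ η η' ↦ by rw [← Complex.add_re]; congr 1; simp only [inner_add_right]; ring)
    (fun a ξ η ↦ by
      rw [smul_eq_mul, ← Complex.re_ofReal_mul]; congr 1
      simp only [inner_smul_right_eq_smul, Complex.real_smul]; ring)

lemma fsForm_apply (z ξ η : Homog m) : fsForm z ξ η =
    (inner ℂ ξ η / (‖z‖ : ℂ) ^ 2 - inner ℂ ξ z * inner ℂ z η / (‖z‖ : ℂ) ^ 4).re := rfl

lemma fsForm_symm (z ξ η : Homog m) : fsForm z ξ η = fsForm z η ξ := by
  rw [fsForm_apply, fsForm_apply, ← Complex.conj_re]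
  congr 1
  simp only [map_sub, map_div₀, map_mul, map_pow, Complex.conj_ofReal, inner_conj_symm]
  ring

lemma fsForm_smul_add {z : Homog m} (hz : z ≠ 0) {a : ℂ} (ha : a ≠ 0) (b c : ℂ) (ξ η : Homog m) :
    fsForm (a • z) (a • ξ + b • z) (a • η + c • z) = fsForm z ξ η := by
  have hz' : (‖z‖ : ℂ) ≠ 0 := by simpa using hz
  have ha' : (starRingEnd ℂ) a ≠ 0 := by simpa using ha
  have h2 : (‖a‖ : ℂ) ^ 2 = (starRingEnd ℂ) a * a := (Complex.conj_mul' a).symm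
  have h4 : (‖a‖ : ℂ) ^ 4 = ((starRingEnd ℂ) a * a) ^ 2 := by rw [← h2]; ring
  rw [fsForm_apply, fsForm_apply]
  congr 1
  simp only [norm_smul, Complex.ofReal_mul, inner_add_left, inner_add_right, inner_smul_left,
    inner_smul_right, inner_self_eq_norm_sq_to_K, Complex.coe_algebraMap, mul_pow, h2, h4]
  field_simp
  ring

/-- The linear map `insertZero i` is the derivative of `insertOne i`, and `insertOne i` composed
with the affine coordinates is `z ↦ z / z i`. -/
lemma insertZero_fderiv_affineCoord (i : Fin (m + 1)) {z : Homog m} (hz : z i ≠ 0) (ξ : Homog m) :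
    ∃ b : ℂ, insertZero i (fderiv ℝ (affineCoord i) z ξ) = (z i)⁻¹ • ξ + b • z := by
  have h1 : HasFDerivAt (affineCoord i) (fderiv ℝ (affineCoord i) z) z :=
    ((contDiffAt_affineCoord (n := 1) i hz).differentiableAt one_ne_zero).hasFDerivAt
  have h2 : HasFDerivAt (fun y : Homog m ↦ insertOne i (affineCoord i y))
      ((insertZero i).comp (fderiv ℝ (affineCoord i) z)) z :=
    ((insertZero i).hasFDerivAt.comp z h1).add_const _
  have h3 : DifferentiableAt ℝ (fun y : Homog m ↦ (y i)⁻¹) z :=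
    ((contDiff_coord (n := 1) i).contDiffAt.inv hz).differentiableAt one_ne_zero
  have h4 := h3.hasFDerivAt.smul (hasFDerivAt_id (𝕜 := ℝ) z)
  have h5 : (fun y : Homog m ↦ insertOne i (affineCoord i y)) =ᶠ[nhds z]
      fun y : Homog m ↦ (y i)⁻¹ • id y := by
    filter_upwards [(contDiff_coord (n := 0) i).continuous.continuousAt.eventually_ne hz] with y hy
    exact insertOne_affineCoord i hy
  have h6 := (h4.congr_of_eventuallyEq h5).unique h2
  refine ⟨fderiv ℝ (fun y : Homog m ↦ (y i)⁻¹) z ξ, ?_⟩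
  have := congrArg (fun L ↦ L ξ) h6
  simpa using this.symm

/-- The form at `z` depends only on the images of the vectors under the projection `z ↦ [z]`. -/
lemma fsForm_fderiv_affineCoord (i : Fin (m + 1)) {z : Homog m} (hz : z i ≠ 0) (ξ η : Homog m) :
    fsForm (insertOne i (affineCoord i z)) (insertZero i (fderiv ℝ (affineCoord i) z ξ))
      (insertZero i (fderiv ℝ (affineCoord i) z η)) = fsForm z ξ η := by
  obtain ⟨b, hb⟩ := insertZero_fderiv_affineCoord i hz ξ
  obtain ⟨c, hc⟩ := insertZero_fderiv_affineCoord i hz η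
  have hz0 : z ≠ 0 := by rintro rfl; simp at hz
  rw [hb, hc, insertOne_affineCoord i hz, fsForm_smul_add hz0 (inv_ne_zero hz)]

lemma contDiff_fsForm_insertOne {n : ℕ∞ω} (i : Fin (m + 1)) (ξ η : Homog m) :
    ContDiff ℝ n (fun w ↦ fsForm (insertOne i w) ξ η) := by
  have hn : ContDiff ℝ n (fun w ↦ inner ℂ (insertOne i w) (insertOne i w)) :=
    (contDiff_insertOne i).inner ℂ (contDiff_insertOne i)
  have h0 : ∀ w, inner ℂ (insertOne i w) (insertOne i w) ≠ 0 := fun w ↦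
    inner_self_ne_zero.2 (insertOne_ne_zero i w)
  have h : ∀ w, fsForm (insertOne i w) ξ η = Complex.reCLM
      (inner ℂ ξ η * (inner ℂ (insertOne i w) (insertOne i w))⁻¹ -
        inner ℂ ξ (insertOne i w) * inner ℂ (insertOne i w) η *
          ((inner ℂ (insertOne i w) (insertOne i w))⁻¹) ^ 2) := by
    intro w
    rw [fsForm_apply, inner_self_eq_norm_sq_to_K, Complex.reCLM_apply]
    congr 1
    simp only [Complex.coe_algebraMap]
    ring
  simp only [h]
  exact Complex.reCLM.contDiff.comp ((contDiff_const.mul (hn.inv h0)).sub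
    (((contDiff_const.inner ℂ (contDiff_insertOne i)).mul
      ((contDiff_insertOne i).inner ℂ contDiff_const)).mul ((hn.inv h0).pow 2)))

/-- A lower bound for the form, which gives its positivity. -/
lemma norm_sq_le_fsForm (i : Fin (m + 1)) (w u : Fin m → ℂ) :
    ‖insertZero i u‖ ^ 2 ≤
      ‖insertOne i w‖ ^ 4 * fsForm (insertOne i w) (insertZero i u) (insertZero i u) := by
  have hN : ‖insertOne i w‖ ^ 2 = 1 + ‖insertZero i w‖ ^ 2 := by
    rw [EuclideanSpace.norm_sq_eq, EuclideanSpace.norm_sq_eq, Fin.sum_univ_succAbove _ i,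
      Fin.sum_univ_succAbove _ i]
    simp
  have hI : inner ℂ (insertOne i w) (insertZero i u) =
      inner ℂ (insertZero i w) (insertZero i u) := by
    simp [insertOne, EuclideanSpace.inner_single_left]
  have h0 : ‖insertOne i w‖ ≠ 0 := norm_ne_zero_iff.2 (insertOne_ne_zero i w)
  have hF : fsForm (insertOne i w) (insertZero i u) (insertZero i u) =
      ‖insertZero i u‖ ^ 2 / ‖insertOne i w‖ ^ 2 -
        ‖inner ℂ (insertZero i w) (insertZero i u)‖ ^ 2 / ‖insertOne i w‖ ^ 4 := by
    rw [fsForm_apply, ← Complex.ofReal_re (_ - _)]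
    congr 1
    rw [← inner_conj_symm (insertZero i u) (insertOne i w), hI, Complex.conj_mul',
      inner_self_eq_norm_sq_to_K]
    push_cast
    rfl
  have hCS : ‖inner ℂ (insertZero i w) (insertZero i u)‖ ^ 2 ≤
      ‖insertZero i w‖ ^ 2 * ‖insertZero i u‖ ^ 2 := by
    rw [← mul_pow]
    exact pow_le_pow_left₀ (norm_nonneg _) (norm_inner_le_norm _ _) 2
  have hE : ‖insertOne i w‖ ^ 4 * fsForm (insertOne i w) (insertZero i u) (insertZero i u) =
      ‖insertOne i w‖ ^ 2 * ‖insertZero i u‖ ^ 2 -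
        ‖inner ℂ (insertZero i w) (insertZero i u)‖ ^ 2 := by
    rw [hF]
    field_simp
  rw [hE, hN]
  linarith

lemma norm_le_norm_insertZero (i : Fin (m + 1)) (u : Fin m → ℂ) : ‖u‖ ≤ ‖insertZero i u‖ :=
  (pi_norm_le_iff_of_nonneg (norm_nonneg _)).2 fun k ↦ by
    simpa using PiLp.norm_apply_le (insertZero i u) (i.succAbove k)

/-- The Fubini–Study inner product, of holomorphic sectional curvature `c`, on the tangent space
at `p`. A tangent vector at `p` is represented by its components `u` in the affine chart `i` at
`p`; the chart lifts `p` to the vector `insertOne i (affineChart i p)` and `u` to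
`insertZero i u`. -/
def fubiniStudyInner (c : ℝ) (p : CP m) :
    TangentSpace 𝓘(ℝ, Fin m → ℂ) p →L[ℝ] TangentSpace 𝓘(ℝ, Fin m → ℂ) p →L[ℝ] ℝ :=
  (4 / c) • ((fsForm (insertOne (chartIdx p) (affineChart (chartIdx p) p))).bilinearComp
    (insertZero (chartIdx p)) (insertZero (chartIdx p)) :
      (Fin m → ℂ) →L[ℝ] (Fin m → ℂ) →L[ℝ] ℝ)

lemma fubiniStudyInner_apply (c : ℝ) (p : CP m) (u v : Fin m → ℂ) :
    fubiniStudyInner c p u v = 4 / c * fsForm (insertOne (chartIdx p) (affineChart (chartIdx p) p))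
      (insertZero (chartIdx p) u) (insertZero (chartIdx p) v) := rfl

lemma fubiniStudyInner_tangentCoordChange (c : ℝ) {p q : CP m}
    (hq : q ∈ (affineChart (chartIdx p)).source) (u v : Fin m → ℂ) :
    fubiniStudyInner c q (tangentCoordChange 𝓘(ℝ, Fin m → ℂ) p q q u)
      (tangentCoordChange 𝓘(ℝ, Fin m → ℂ) p q q v) =
    4 / c * fsForm (insertOne (chartIdx p) (affineChart (chartIdx p) q))
      (insertZero (chartIdx p) u) (insertZero (chartIdx p) v) := by
  set i := chartIdx p
  set j := chartIdx q with hj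
  set z := insertOne i (affineChart i q) with hz
  have hqz : q = Projectivization.mk ℂ z (insertOne_ne_zero _ _) :=
    ((affineChart i).left_inv hq).symm
  have hzj : z j ≠ 0 := by
    have := mem_chartIdx_source q
    rw [← hj, hqz] at this
    exact this
  have hT : ∀ u, tangentCoordChange 𝓘(ℝ, Fin m → ℂ) p q q u =
      fderiv ℝ (affineCoord j) z (insertZero i u) := by
    intro u
    have h1 : HasFDerivAt (affineCoord j) (fderiv ℝ (affineCoord j) z) z :=
      ((contDiffAt_affineCoord (n := 1) j hzj).differentiableAt one_ne_zero).hasFDerivAt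
    have h2 : HasFDerivAt (insertOne i) (insertZero i) (affineChart i q) :=
      (insertZero i).hasFDerivAt.add_const _
    have h3 := h1.comp (affineChart i q) h2
    rw [tangentCoordChange_def]
    simp only [modelWithCornersSelf_coe, Set.range_id, fderivWithin_univ]
    exact congrArg (fun L ↦ L u) h3.fderiv
  rw [hT, hT, fubiniStudyInner_apply, ← hj]
  have : affineChart j q = affineCoord j z := by rw [hqz]; rfl
  rw [this, fsForm_fderiv_affineCoord j hzj]

/-- The Fubini–Study metric of `ℂℙᵐ` with constant holomorphic sectional curvature `c > 0`. -/
def fubiniStudy (m : ℕ) (c : ℝ) (hc : 0 < c) :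
    Bundle.ContMDiffRiemannianMetric 𝓘(ℝ, Fin m → ℂ) ∞ (Fin m → ℂ)
      (fun p : CP m ↦ TangentSpace 𝓘(ℝ, Fin m → ℂ) p) where
  inner := fubiniStudyInner c
  symm p u v := by
    exact congrArg (4 / c * ·) (fsForm_symm _ _ _)
  pos p u hu := by
    refine mul_pos (div_pos four_pos hc) ?_
    set i := chartIdx p
    have h := norm_sq_le_fsForm i (affineChart i p) u
    have hu' : 0 < ‖insertZero i u‖ := (norm_pos_iff.2 hu).trans_le (norm_le_norm_insertZero i u)
    exact pos_of_mul_pos_right ((pow_pos hu' 2).trans_le h) (by positivity)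
  isVonNBounded p := by
    set i := chartIdx p with hi
    set N := ‖insertOne i (affineChart i p)‖
    refine (NormedSpace.isVonNBounded_iff' ℝ (E := Fin m → ℂ)).2 ⟨1 + N ^ 4 * (c / 4), ?_⟩
    intro u hu
    have hu1 : 4 / c * fsForm (insertOne i (affineChart i p)) (insertZero i u) (insertZero i u)
      < 1 := hu
    have hu2 : fsForm (insertOne i (affineChart i p)) (insertZero i u) (insertZero i u)
        ≤ c / 4 := by
      rw [div_mul_eq_mul_div, div_lt_one hc] at hu1
      linarith
    have h := norm_sq_le_fsForm i (affineChart i p) u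
    have h1 := norm_le_norm_insertZero i u
    have h2 := mul_le_mul_of_nonneg_left hu2 (show 0 ≤ N ^ 4 by positivity)
    change ‖(u : Fin m → ℂ)‖ ≤ _
    nlinarith [norm_nonneg (insertZero i u), sq_nonneg (‖insertZero i u‖ - 1)]
  contMDiff := by
    intro p
    rw [Bundle.contMDiffAt_section]
    set i := chartIdx p with hi
    have h1 : ContDiff ℝ ∞ (fun w ↦ (4 / c) • (fsForm (insertOne i w)).bilinearComp
        (insertZero i) (insertZero i)) := by
      refine ContDiff.const_smul (4 / c) (contDiff_clm_apply_iff.2 fun u ↦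
        contDiff_clm_apply_iff.2 fun v ↦ ?_)
      exact contDiff_fsForm_insertOne i _ _
    have h2 : ContMDiffAt 𝓘(ℝ, Fin m → ℂ) 𝓘(ℝ, Fin m → ℂ) ∞ (affineChart i) p :=
      contMDiffAt_extChartAt (I := 𝓘(ℝ, Fin m → ℂ)) (n := ∞) (x := p)
    refine (h1.contMDiff.contMDiffAt.comp p h2).congr_of_eventuallyEq ?_
    filter_upwards [(affineChart i).open_source.mem_nhds (mem_chartIdx_source p)] with q hq
    ext u v
    have hq' : q ∈ (trivializationAt (Fin m → ℂ)
      (fun p : CP m ↦ TangentSpace 𝓘(ℝ, Fin m → ℂ) p) p).baseSet := hq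
    rw [hom_trivializationAt_apply]
    erw [inCoordinates_apply_eq₂ hq' hq' (Set.mem_univ _)]
    have hs : ∀ u : Fin m → ℂ, (trivializationAt (Fin m → ℂ)
        (fun p : CP m ↦ TangentSpace 𝓘(ℝ, Fin m → ℂ) p) p).symm q u =
        tangentCoordChange 𝓘(ℝ, Fin m → ℂ) p q q u := by
      intro u
      rw [← Bundle.Trivialization.symmL_apply (R := ℝ) _ hq']
      exact congrArg (fun L ↦ L u)
        (TangentBundle.symmL_trivializationAt_eq_core (I := 𝓘(ℝ, Fin m → ℂ)) (b₀ := p) hq)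
    rw [hs, hs]
    refine Eq.trans ?_ (fubiniStudyInner_tangentCoordChange c hq u v)
    exact congrArg (fun L : ℝ →ₗ[ℝ] ℝ ↦ L _) (Bundle.Trivial.linearMapAt_trivialization ℝ (CP m) ℝ q)

end OrthCoord

end

/-! For an orthogonal coordinate system, the curvature components R(∂i,∂j,∂k,∂l) with four distinct
indices vanish. For the Fubini–Study metric these components are quadratic in the complex structure,
and their vanishing says that the matrix J of the complex structure in the orthonormalised
coordinate frame satisfies J_ij J_kl = J_ik J_lj = J_il J_jk for distinct indices. No orthogonal
antisymmetric matrix of size at least 5 does so (`not_orthogonal_of_mul_eq_mul`), and the size here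
is 2m ≥ 6.

The curvature tensor is never formed. The base point is moved to the origin of an affine chart,
where, up to a positive factor, the metric is the flat Hermitian product plus terms quadratic in the
position `f` (`affineHerm`). In `not_orthogonal_jet` the off-diagonal entries and their first two
derivatives at the origin are set to zero: the first derivatives kill the Christoffel symbols with
distinct indices, and in the second derivatives the unknown third-order jet is eliminated by its
symmetry, leaving the relations on J.

The passage from the manifold to this jet rests on the invariance of `fsForm` under rescaling the
lift and adding multiples of the base vector (`not_orthogonal_homogeneous`,
`not_orthogonal_normalized`). -/

open scoped Topology

namespace OrthCoord

/-- There are no three pairwise orthogonal unit vectors in the plane. -/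
lemma not_three_orthogonal_in_plane {a₁ b₁ a₂ b₂ a₃ b₃ : ℝ} (h₁ : a₁ * a₁ + b₁ * b₁ = 1)
    (h₂ : a₂ * a₂ + b₂ * b₂ = 1) (h₃ : a₃ * a₃ + b₃ * b₃ = 1) (h₁₂ : a₁ * a₂ + b₁ * b₂ = 0)
    (h₁₃ : a₁ * a₃ + b₁ * b₃ = 0) (h₂₃ : a₂ * a₃ + b₂ * b₃ = 0) : False := by
  grind

lemma exists_notMem_of_card_lt {ι : Type*} [Fintype ι] [DecidableEq ι] (s : Finset ι)
    (h : s.card < Fintype.card ι) : ∃ p, p ∉ s := by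
  by_contra! hs
  rw [Finset.eq_univ_of_forall hs, Finset.card_univ] at h
  exact h.false

/-- An orthogonal antisymmetric matrix of size at least `5` cannot satisfy
`J_ij J_kl = J_ik J_lj = J_il J_jk` for all distinct `i, j, k, l`. -/
lemma not_orthogonal_of_mul_eq_mul {ι : Type*} [Fintype ι] [DecidableEq ι]
    (hι : 5 ≤ Fintype.card ι) (J : ι → ι → ℝ) (hanti : ∀ i j, J i j = -J j i)
    (horth : ∀ i j, ∑ l, J i l * J j l = if i = j then 1 else 0)
    (h : ∀ i j k l, i ≠ j → i ≠ k → i ≠ l → j ≠ k → j ≠ l → k ≠ l →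
      J i j * J k l = J i k * J l j ∧ J i j * J k l = J i l * J j k) : False := by
  have hdiag : ∀ i, J i i = 0 := fun i ↦ by linarith [hanti i i]
  have hrow : ∀ i, ∃ j, J i j ≠ 0 := by
    intro i
    by_contra! hi
    simpa [hi] using horth i i
  have hfresh : ∀ s : Finset ι, s.card ≤ 4 → ∃ p, p ∉ s := fun s hs ↦
    exists_notMem_of_card_lt s (by omega)
  obtain ⟨i, -⟩ := hfresh ∅ (by simp)
  obtain ⟨j, hij⟩ := hrow i
  have hne : i ≠ j := by rintro rfl; exact hij (hdiag i)
  -- Either some nonzero entry has both indices outside {i, j}, or every row other than i and j is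
  -- supported in the columns i and j.
  by_cases hex : ∃ k l, k ≠ i ∧ k ≠ j ∧ l ≠ i ∧ l ≠ j ∧ J k l ≠ 0
  · obtain ⟨k, l, hki, hkj, hli, hlj, hkl⟩ := hex
    have hkl' : k ≠ l := by rintro rfl; exact hkl (hdiag k)
    obtain ⟨p, hp⟩ := hfresh {i, j, k, l} Finset.card_le_four
    simp only [Finset.mem_insert, Finset.mem_singleton, not_or] at hp
    obtain ⟨hpi, hpj, hpk, hpl⟩ : p ≠ i ∧ p ≠ j ∧ p ≠ k ∧ p ≠ l := hp
    obtain ⟨q, hpq⟩ := hrow p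
    have hqp : p ≠ q := by rintro rfl; exact hpq (hdiag p)
    have h0 := h i j k l hne hki.symm hli.symm hkj.symm hlj.symm hkl'
    -- The relations make the 2×2 permanents of rows i and p vanish. So the ratios J_pa / J_ia sum
    -- to zero in pairs over three columns, which forces each of them to be zero.
    have hperm : ∀ a b c, a ≠ i → a ≠ p → b ≠ i → b ≠ p → c ≠ i → c ≠ p → a ≠ b → b ≠ c → a ≠ c →
        J i a ≠ 0 → J i b ≠ 0 → J i c ≠ 0 → J p a = 0 := by
      intro a b c hai hap hbi hbp hci hcp hab hbc hac ha hb hc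
      have h1 := h i p a b hpi.symm hai.symm hbi.symm hap.symm hbp.symm hab
      have h2 := h i p a c hpi.symm hai.symm hci.symm hap.symm hcp.symm hac
      have h3 := h i p b c hpi.symm hbi.symm hci.symm hbp.symm hcp.symm hbc
      rw [hanti b p] at h1
      rw [hanti c p] at h2 h3
      have e1 : J i a * J p b = - (J i b * J p a) := by linarith [h1.1, h1.2]
      have e2 : J i a * J p c = - (J i c * J p a) := by linarith [h2.1, h2.2]
      have e3 : J i b * J p c = - (J i c * J p b) := by linarith [h3.1, h3.2]
      have e4 : J i b * J i c * J p a = 0 := by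
        linear_combination (J i c / 2) * e1 + (J i b / 2) * e2 + (-J i a / 2) * e3
      simpa [hb, hc] using e4
    have hik : J i k ≠ 0 := fun h' ↦ mul_ne_zero hij hkl (by rw [h0.1, h', zero_mul])
    have hil : J i l ≠ 0 := fun h' ↦ mul_ne_zero hij hkl (by rw [h0.2, h', zero_mul])
    have z1 : J p j = 0 := hperm j k l hne.symm hpj.symm hki hpk.symm hli hpl.symm hkj.symm hkl'
      hlj.symm hij hik hil
    have z2 : J p k = 0 := hperm k j l hki hpk.symm hne.symm hpj.symm hli hpl.symm hkj hlj.symm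
      hkl' hik hij hil
    have h1 := h i p j k hpi.symm hne hki.symm hpj hpk hkj.symm
    -- J_ip J_jk is a multiple of J_kp = 0, while J_jk ≠ 0. With J_pi = J_pj = 0, the nonzero entry
    -- of row p lies in a column q outside {i, j}, and J_ij J_pq = J_ip J_qj = 0 is absurd.
    have z3 : J p i = 0 := by
      have : J i p * J j k = 0 := by rw [h1.1, hanti k p, z2]; simp
      have hjk : J j k ≠ 0 := fun h' ↦ mul_ne_zero hij hkl (by rw [h0.2, h', mul_zero])
      rw [hanti p i, neg_eq_zero]
      simpa [hjk] using this
    have hqi : q ≠ i := by rintro rfl; exact hpq z3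
    have hqj : q ≠ j := by rintro rfl; exact hpq z1
    have h2 := h i j p q hne hpi.symm hqi.symm hpj.symm hqj.symm hqp
    rw [hanti i p, z3] at h2
    exact mul_ne_zero hij hpq (by simpa using h2.1)
  · push Not at hex
    obtain ⟨p, hp⟩ := hfresh {i, j} (Finset.card_le_two.trans (by norm_num))
    obtain ⟨q, hq⟩ := hfresh {i, j, p} (Finset.card_le_three.trans (by norm_num))
    obtain ⟨r, hr⟩ := hfresh {i, j, p, q} Finset.card_le_four
    simp only [Finset.mem_insert, Finset.mem_singleton, not_or] at hp hq hr
    -- Rows p, q, r reduce to their entries in columns i and j, so they would be three orthonormal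
    -- vectors in a plane; this uses five indices.
    have hsum : ∀ a b, a ≠ i → a ≠ j →
        J a i * J b i + J a j * J b j = if a = b then 1 else 0 := by
      intro a b hai haj
      rw [← horth a b, ← Finset.sum_pair (f := fun l ↦ J a l * J b l) hne]
      refine Finset.sum_subset (Finset.subset_univ _) fun l _ hl ↦ ?_
      simp only [Finset.mem_insert, Finset.mem_singleton, not_or] at hl
      rw [hex a l hai haj hl.1 hl.2, zero_mul]
    refine not_three_orthogonal_in_plane (a₁ := J p i) (b₁ := J p j) (a₂ := J q i) (b₂ := J q j)
      (a₃ := J r i) (b₃ := J r j) ?_ ?_ ?_ ?_ ?_ ?_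
    · simpa using hsum p p hp.1 hp.2
    · simpa using hsum q q hq.1 hq.2.1
    · simpa using hsum r r hr.1 hr.2.1
    · simpa [Ne.symm hq.2.2] using hsum p q hp.1 hp.2
    · simpa [Ne.symm hr.2.2.1] using hsum p r hp.1 hp.2
    · simpa [Ne.symm hr.2.2.2] using hsum q r hq.1 hq.2.1

/-! ### Directional derivatives and the Leibniz rule -/

section Calculus

variable {E F G H : Type*} [NormedAddCommGroup E] [NormedSpace ℝ E]
  [NormedAddCommGroup F] [NormedSpace ℝ F] [NormedAddCommGroup G] [NormedSpace ℝ G]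
  [NormedAddCommGroup H] [NormedSpace ℝ H]

/-- The derivative of `f` in the direction `a`, as a function of the point. -/
noncomputable def dirDeriv (a : E) (f : E → F) (x : E) : F := fderiv ℝ f x a

/-- `f` is smooth at each point of `U`. -/
def SmoothOn (U : Set E) (f : E → F) : Prop := ∀ x ∈ U, ContDiffAt ℝ ∞ f x

variable {U : Set E} {f : E → F} {g : E → G} {x : E}

lemma SmoothOn.differentiableAt (hf : SmoothOn U f) (hx : x ∈ U) : DifferentiableAt ℝ f x :=
  (hf x hx).differentiableAt (by simp)

lemma SmoothOn.dirDeriv (hf : SmoothOn U f) (a : E) : SmoothOn U (dirDeriv a f) := fun x hx ↦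
  ((hf x hx).fderiv_right (m := ∞) (by simp)).clm_apply contDiffAt_const

lemma SmoothOn.bilinear (B : F →L[ℝ] G →L[ℝ] H) (hf : SmoothOn U f) (hg : SmoothOn U g) :
    SmoothOn U (fun y ↦ B (f y) (g y)) := fun x hx ↦
  (B.contDiff.contDiffAt.comp x (hf x hx)).clm_apply (hg x hx)

lemma dirDeriv_congr {f₁ f₂ : E → F} (hU : IsOpen U) (h : Set.EqOn f₁ f₂ U) (a : E) :
    Set.EqOn (dirDeriv a f₁) (dirDeriv a f₂) U := fun x hx ↦ by
  have : f₁ =ᶠ[𝓝 x] f₂ := by filter_upwards [hU.mem_nhds hx] with y hy using h hy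
  simp [dirDeriv, this.fderiv_eq]

lemma dirDeriv_const (a : E) (v : F) : dirDeriv a (fun _ : E ↦ v) = fun _ ↦ 0 := by
  ext x; simp [dirDeriv]

lemma dirDeriv_add {f₁ f₂ : E → F} (h₁ : SmoothOn U f₁) (h₂ : SmoothOn U f₂) (a : E) :
    Set.EqOn (dirDeriv a (fun y ↦ f₁ y + f₂ y))
      (fun y ↦ dirDeriv a f₁ y + dirDeriv a f₂ y) U := fun x hx ↦ by
  simp [dirDeriv, fderiv_fun_add (h₁.differentiableAt hx) (h₂.differentiableAt hx)]

lemma dirDeriv_bilinear (B : F →L[ℝ] G →L[ℝ] H) (hf : SmoothOn U f) (hg : SmoothOn U g) (a : E) :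
    Set.EqOn (dirDeriv a (fun y ↦ B (f y) (g y)))
      (fun y ↦ B (dirDeriv a f y) (g y) + B (f y) (dirDeriv a g y)) U := fun x hx ↦ by
  simp [dirDeriv, B.fderiv_of_bilinear (hf.differentiableAt hx) (hg.differentiableAt hx), add_comm]

lemma dirDeriv_clm (L : F →L[ℝ] G) (hf : SmoothOn U f) (a : E) :
    Set.EqOn (dirDeriv a (fun y ↦ L (f y))) (fun y ↦ L (dirDeriv a f y)) U := fun x hx ↦ by
  have := (L.hasFDerivAt.comp x (hf.differentiableAt hx).hasFDerivAt).fderiv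
  exact congrArg (fun T ↦ T a) this

lemma dirDeriv_dirDeriv_bilinear (hU : IsOpen U) (B : F →L[ℝ] G →L[ℝ] H) (hf : SmoothOn U f)
    (hg : SmoothOn U g) (a b : E) (hx : x ∈ U) :
    dirDeriv b (dirDeriv a (fun y ↦ B (f y) (g y))) x =
      B (dirDeriv b (dirDeriv a f) x) (g x) + B (dirDeriv a f x) (dirDeriv b g x) +
      (B (dirDeriv b f x) (dirDeriv a g x) + B (f x) (dirDeriv b (dirDeriv a g) x)) := by
  rw [dirDeriv_congr hU (dirDeriv_bilinear B hf hg a) b hx,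
    dirDeriv_add ((hf.dirDeriv a).bilinear B hg) (hf.bilinear B (hg.dirDeriv a)) b hx]
  exact congrArg₂ (· + ·) (dirDeriv_bilinear B (hf.dirDeriv a) hg b hx)
    (dirDeriv_bilinear B hf (hg.dirDeriv a) b hx)

lemma dirDeriv_comm (hf : SmoothOn U f) (a b : E) :
    Set.EqOn (dirDeriv a (dirDeriv b f)) (dirDeriv b (dirDeriv a f)) U := fun x hx ↦ by
  have hd : DifferentiableAt ℝ (fderiv ℝ f) x :=
    ((hf x hx).fderiv_right (m := 1) (by norm_cast)).differentiableAt (by simp)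
  have key : ∀ a b, dirDeriv a (dirDeriv b f) x = fderiv ℝ (fderiv ℝ f) x a b := by
    intro a b
    change fderiv ℝ (fun y ↦ fderiv ℝ f y b) x a = _
    rw [fderiv_clm_apply hd (differentiableAt_const b)]
    simp
  rw [key, key]
  exact ((hf x hx).isSymmSndFDerivAt (by simp; norm_cast)).eq a b

lemma SmoothOn.add {f₁ f₂ : E → F} (h₁ : SmoothOn U f₁) (h₂ : SmoothOn U f₂) :
    SmoothOn U (fun y ↦ f₁ y + f₂ y) := fun x hx ↦ (h₁ x hx).add (h₂ x hx)

lemma dirDeriv_dirDeriv_add {f₁ f₂ : E → F} (hU : IsOpen U) (h₁ : SmoothOn U f₁)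
    (h₂ : SmoothOn U f₂) (a b : E) :
    Set.EqOn (dirDeriv b (dirDeriv a (fun y ↦ f₁ y + f₂ y)))
      (fun y ↦ dirDeriv b (dirDeriv a f₁) y + dirDeriv b (dirDeriv a f₂) y) U :=
  (dirDeriv_congr hU (dirDeriv_add h₁ h₂ a) b).trans (dirDeriv_add (h₁.dirDeriv a) (h₂.dirDeriv a) b)

lemma re_dirDeriv_eq_zero (hU : IsOpen U) {q : E → ℂ} (hq : SmoothOn U q)
    (h : ∀ y ∈ U, (q y).re = 0) (a : E) : ∀ y ∈ U, (dirDeriv a q y).re = 0 := by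
  intro y hy
  have h1 : Set.EqOn (fun y ↦ Complex.reCLM (q y)) (fun _ ↦ 0) U := fun y hy ↦ h y hy
  have h2 := dirDeriv_congr hU h1 a hy
  rw [dirDeriv_clm Complex.reCLM hq a hy, dirDeriv_const] at h2
  exact h2

end Calculus

/-! ### Two-jet of the Fubini–Study form at the origin of an affine chart -/

section Form

variable {E V : Type*} [NormedAddCommGroup E] [NormedSpace ℝ E] [NormedAddCommGroup V]
  [InnerProductSpace ℂ V] [NormedSpace ℝ V] [IsScalarTower ℝ ℂ V]

/-- The Hermitian product as a continuous real-bilinear map. -/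
noncomputable def hermL : V →L[ℝ] V →L[ℝ] ℂ :=
  LinearMap.mkContinuous₂ (LinearMap.mk₂ ℝ (fun u v ↦ inner ℂ u v)
    (fun _ _ _ ↦ inner_add_left _ _ _) (fun _ _ _ ↦ inner_smul_left_eq_smul _ _ _)
    (fun _ _ _ ↦ inner_add_right _ _ _) (fun _ _ _ ↦ inner_smul_right_eq_smul _ _ _)) 1
    (fun u v ↦ by simpa using norm_inner_le_norm u v)

lemma hermL_apply (u v : V) : hermL u v = inner ℂ u v := rfl

/-- The Hermitian product of the vectors `∂_a f` and `∂_b f` in the Fubini–Study metric, in the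
affine coordinates `f`, up to the factor `(1 + ‖f‖²)²`. -/
noncomputable def affineHerm (f : E → V) (a b y : E) : ℂ :=
  hermL (dirDeriv a f y) (dirDeriv b f y) +
    (hermL (f y) (f y) * hermL (dirDeriv a f y) (dirDeriv b f y) +
      -(hermL (dirDeriv a f y) (f y) * hermL (f y) (dirDeriv b f y)))

variable {U : Set E} {f : E → V} {x : E}

/-- The form is definitionally a sum of values of the bilinear maps `hermL`, `mul` and `-mul`, so
the bilinear calculus applies to it directly. -/
lemma SmoothOn.affineHerm (hf : SmoothOn U f) (a b : E) : SmoothOn U (affineHerm f a b) :=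
  ((hf.dirDeriv a).bilinear hermL (hf.dirDeriv b)).add
    (((hf.bilinear hermL hf).bilinear (ContinuousLinearMap.mul ℝ ℂ)
      ((hf.dirDeriv a).bilinear hermL (hf.dirDeriv b))).add
    (((hf.dirDeriv a).bilinear hermL hf).bilinear (-ContinuousLinearMap.mul ℝ ℂ)
      (hf.bilinear hermL (hf.dirDeriv b))))

/-- The quartic terms contain `f` twice and so vanish to second order where `f` does: at first order
only the flat product is seen. -/
lemma dirDeriv_affineHerm (hf : SmoothOn U f) (hx : x ∈ U) (hfx : f x = 0) (a b c : E) :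
    dirDeriv c (affineHerm f a b) x =
      inner ℂ (dirDeriv c (dirDeriv a f) x) (dirDeriv b f x) +
        inner ℂ (dirDeriv a f x) (dirDeriv c (dirDeriv b f) x) := by
  have hR := (hf.dirDeriv a).bilinear hermL (hf.dirDeriv b)
  have hP := hf.bilinear hermL hf
  have hL := (hf.dirDeriv a).bilinear hermL hf
  have hM := hf.bilinear hermL (hf.dirDeriv b)
  have e1 := dirDeriv_add hR ((hP.bilinear (ContinuousLinearMap.mul ℝ ℂ) hR).add
    (hL.bilinear (-ContinuousLinearMap.mul ℝ ℂ) hM)) c hx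
  have e2 := dirDeriv_add (hP.bilinear (ContinuousLinearMap.mul ℝ ℂ) hR)
    (hL.bilinear (-ContinuousLinearMap.mul ℝ ℂ) hM) c hx
  have e3 := dirDeriv_bilinear (ContinuousLinearMap.mul ℝ ℂ) hP hR c hx
  have e4 := dirDeriv_bilinear (-ContinuousLinearMap.mul ℝ ℂ) hL hM c hx
  have e5 := dirDeriv_bilinear hermL (hf.dirDeriv a) (hf.dirDeriv b) c hx
  have e6 := dirDeriv_bilinear hermL hf hf c hx
  refine e1.trans ?_
  simp only [e2, e3, e4, e5, e6]
  simp only [hfx, map_zero, zero_apply, add_zero, hermL_apply]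

/-- From the quartic terms there survive exactly those where each derivative falls on one of the two
factors `f`. These products of first derivatives carry the curvature. -/
lemma dirDeriv_dirDeriv_affineHerm (hU : IsOpen U) (hf : SmoothOn U f) (hx : x ∈ U)
    (hfx : f x = 0) (a b c d : E) :
    dirDeriv d (dirDeriv c (affineHerm f a b)) x =
      inner ℂ (dirDeriv d (dirDeriv c (dirDeriv a f)) x) (dirDeriv b f x) +
        inner ℂ (dirDeriv c (dirDeriv a f) x) (dirDeriv d (dirDeriv b f) x) +
        inner ℂ (dirDeriv d (dirDeriv a f) x) (dirDeriv c (dirDeriv b f) x) +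
        inner ℂ (dirDeriv a f x) (dirDeriv d (dirDeriv c (dirDeriv b f)) x) +
        (inner ℂ (dirDeriv c f x) (dirDeriv d f x) + inner ℂ (dirDeriv d f x) (dirDeriv c f x)) *
          inner ℂ (dirDeriv a f x) (dirDeriv b f x) -
        (inner ℂ (dirDeriv a f x) (dirDeriv c f x) * inner ℂ (dirDeriv d f x) (dirDeriv b f x) +
          inner ℂ (dirDeriv a f x) (dirDeriv d f x) * inner ℂ (dirDeriv c f x) (dirDeriv b f x)) := by
  have hR := (hf.dirDeriv a).bilinear hermL (hf.dirDeriv b)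
  have hP := hf.bilinear hermL hf
  have hL := (hf.dirDeriv a).bilinear hermL hf
  have hM := hf.bilinear hermL (hf.dirDeriv b)
  have e1 := dirDeriv_dirDeriv_add hU hR ((hP.bilinear (ContinuousLinearMap.mul ℝ ℂ) hR).add
    (hL.bilinear (-ContinuousLinearMap.mul ℝ ℂ) hM)) c d hx
  have e2 := dirDeriv_dirDeriv_add hU (hP.bilinear (ContinuousLinearMap.mul ℝ ℂ) hR)
    (hL.bilinear (-ContinuousLinearMap.mul ℝ ℂ) hM) c d hx
  have e3 := dirDeriv_dirDeriv_bilinear hU (ContinuousLinearMap.mul ℝ ℂ) hP hR c d hx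
  have e4 := dirDeriv_dirDeriv_bilinear hU (-ContinuousLinearMap.mul ℝ ℂ) hL hM c d hx
  have e5 := dirDeriv_dirDeriv_bilinear hU hermL (hf.dirDeriv a) (hf.dirDeriv b) c d hx
  have e6 := dirDeriv_dirDeriv_bilinear hU hermL hf hf c d hx
  have e7 := fun c ↦ dirDeriv_bilinear hermL (hf.dirDeriv a) hf c hx
  have e8 := fun c ↦ dirDeriv_bilinear hermL hf (hf.dirDeriv b) c hx
  have e9 := fun c ↦ dirDeriv_bilinear hermL hf hf c hx
  refine e1.trans ?_
  simp only [e2, e3, e4, e5, e6, e7, e8, e9]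
  simp only [hfx, map_zero, zero_apply, zero_add, add_zero, hermL_apply, neg_apply,
    ContinuousLinearMap.mul_apply']
  ring

end Form

/-! ### Algebraic contradiction from the jets of order one, two and three -/

section Pointwise

variable {V : Type*} [NormedAddCommGroup V] [InnerProductSpace ℂ V]
  {ι : Type*} [Fintype ι] [DecidableEq ι]

/-- Parseval's identity for a real orthonormal basis of a complex inner product space. -/
lemma sum_re_inner_mul_re_inner [FiniteDimensional ℂ V]
    (hι : Fintype.card ι = 2 * Module.finrank ℂ V) (e : ι → V)
    (he : ∀ i j, (inner ℂ (e i) (e j)).re = if i = j then 1 else 0) (u u' : V) :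
    ∑ p, (inner ℂ u (e p)).re * (inner ℂ (e p) u').re = (inner ℂ u u').re := by
  let _ : InnerProductSpace ℝ V := InnerProductSpace.complexToReal
  have hr : ∀ a b : V, inner ℝ a b = (inner ℂ a b).re := fun _ _ ↦ rfl
  have ho : Orthonormal ℝ e := by
    rw [orthonormal_iff_ite]
    exact fun i j ↦ he i j
  have hcard : Fintype.card ι = Module.finrank ℝ V := by rw [hι, finrank_real_of_complex]
  have hspan : ⊤ ≤ Submodule.span ℝ (Set.range e) :=
    (ho.linearIndependent.span_eq_top_of_card_eq_finrank' hcard).ge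
  have := (OrthonormalBasis.mk ho hspan).sum_inner_mul_inner u u'
  simpa [hr] using this

lemma inner_eq_im_mul_I {u v : V} (h : (inner ℂ u v).re = 0) :
    inner ℂ u v = ((inner ℂ u v).im : ℂ) * Complex.I := by
  apply Complex.ext <;> simp [h]

/-- The pointwise obstruction to orthogonal coordinates: `v`, `w`, `t` stand for the derivatives of
order `1`, `2`, `3` at the origin of the affine coordinates of the projective space. -/
lemma not_orthogonal_jet [FiniteDimensional ℂ V] (hι : Fintype.card ι = 2 * Module.finrank ℂ V)
    (h5 : 5 ≤ Fintype.card ι) (v : ι → V) (w : ι → ι → V) (t : ι → ι → ι → V)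
    (hw : ∀ i j, w i j = w j i) (ht : ∀ i j k, t i j k = t j i k) (ht' : ∀ i j k, t i j k = t i k j)
    (hv : ∀ i, v i ≠ 0) (h1 : ∀ i j, i ≠ j → (inner ℂ (v i) (v j)).re = 0)
    (h2 : ∀ i j k, i ≠ j → (inner ℂ (w k i) (v j) + inner ℂ (v i) (w k j)).re = 0)
    (h3 : ∀ i j k l, i ≠ j → (inner ℂ (t l k i) (v j) + inner ℂ (w k i) (w l j) +
      inner ℂ (w l i) (w k j) + inner ℂ (v i) (t l k j) +
      (inner ℂ (v k) (v l) + inner ℂ (v l) (v k)) * inner ℂ (v i) (v j) -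
      (inner ℂ (v i) (v k) * inner ℂ (v l) (v j) +
        inner ℂ (v i) (v l) * inner ℂ (v k) (v j))).re = 0) : False := by
  have hre : ∀ a b : V, (inner ℂ a b).re = (inner ℂ b a).re := fun a b ↦ inner_re_symm (𝕜 := ℂ) a b
  have him : ∀ a b : V, (inner ℂ a b).im = -(inner ℂ b a).im := fun a b ↦ inner_im_symm (𝕜 := ℂ) a b
  set e : ι → V := fun i ↦ ((‖v i‖⁻¹ : ℝ) : ℂ) • v i with he
  have hn : ∀ i, ‖v i‖ ≠ 0 := fun i ↦ norm_ne_zero_iff.2 (hv i)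
  have her : ∀ i u, (inner ℂ u (e i)).re = ‖v i‖⁻¹ * (inner ℂ u (v i)).re := by
    intro i u
    rw [he, inner_smul_right, Complex.re_ofReal_mul]
  have hel : ∀ i u, (inner ℂ (e i) u).re = ‖v i‖⁻¹ * (inner ℂ (v i) u).re := by
    intro i u
    rw [hre, her, hre]
  have hon : ∀ i j, (inner ℂ (e i) (e j)).re = if i = j then 1 else 0 := by
    intro i j
    rw [her, hel]
    split_ifs with h
    · subst h
      have : (inner ℂ (v i) (v i)).re = ‖v i‖ ^ 2 := inner_self_eq_norm_sq (𝕜 := ℂ) (v i)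
      rw [this]
      field_simp [hn i]
    · rw [h1 i j h]; simp
  have hP := sum_re_inner_mul_re_inner hι e hon
  -- the Christoffel symbols with three distinct indices vanish
  have hw0 : ∀ i j k, i ≠ j → i ≠ k → j ≠ k → (inner ℂ (w i j) (v k)).re = 0 := by
    intro i j k hij hik hjk
    -- As in the Koszul formula: the three numbers Re⟪w_ij, v_k⟫, Re⟪w_ik, v_j⟫, Re⟪w_jk, v_i⟫ sum
    -- to zero in pairs.
    have a1 := h2 j k i hjk
    have a2 := h2 i k j hik
    have a3 := h2 i j k hij
    rw [Complex.add_re, hre (v _)] at a1 a2 a3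
    rw [hw j i, hw j k] at a2
    rw [hw k i, hw k j, hw j k] at a3
    linarith
  -- Expand in the orthonormal frame: no p lies in both {i, j} and {k, l}, so in each term one
  -- factor is a vanishing Christoffel symbol.
  have hww : ∀ i j k l, i ≠ j → i ≠ k → i ≠ l → j ≠ k → j ≠ l → k ≠ l →
      (inner ℂ (w i j) (w k l)).re = 0 := by
    intro i j k l hij hik hil hjk hjl hkl
    rw [← hP]
    refine Finset.sum_eq_zero fun p _ ↦ ?_
    rw [her, hel]
    by_cases hp : p = i ∨ p = j
    · rw [hre (v p), hw0 k l p hkl (by grind) (by grind)]; simp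
    · rw [hw0 i j p hij (by grind) (by grind)]; simp
  set κ : ι → ι → ℝ := fun i j ↦ (inner ℂ (v i) (v j)).im with hk
  have hkA : ∀ i j, κ i j = -κ j i := fun i j ↦ him _ _
  have hI : ∀ i j k l, i ≠ j → k ≠ l →
      (inner ℂ (v i) (v j) * inner ℂ (v k) (v l)).re = -(κ i j * κ k l) := by
    intro i j k l hij hkl
    rw [Complex.mul_re, h1 i j hij, h1 k l hkl]; simp [hk]
  have htc : ∀ i j k, t i j k = t j k i := fun i j k ↦ by rw [ht, ht']
  have htr : ∀ i j k, t i j k = t k j i := fun i j k ↦ by rw [ht', ht, ht']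
  -- For distinct indices the second-order terms drop out by `hww` and 2 Re⟪v_k, v_l⟫ = 0; only the
  -- third-order jet and products of `κ` remain.
  have h4 : ∀ i j k l, i ≠ j → i ≠ k → i ≠ l → j ≠ k → j ≠ l → k ≠ l →
      (inner ℂ (v j) (t i k l)).re + (inner ℂ (v i) (t j k l)).re =
        -(κ i k * κ l j) - κ i l * κ k j := by
    intro i j k l hij hik hil hjk hjl hkl
    have a := h3 i j k l hij
    have z : inner ℂ (v k) (v l) + inner ℂ (v l) (v k) = 0 := by
      rw [inner_eq_im_mul_I (h1 k l hkl), inner_eq_im_mul_I (h1 l k hkl.symm), him (v k)]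
      push_cast; ring
    rw [z, zero_mul] at a
    simp only [Complex.add_re, Complex.sub_re, add_zero] at a
    rw [hI i k l j hik hjl.symm, hI i l k j hil hjk.symm, hre (t l k i),
      hww k i l j hik.symm hkl hjk.symm hil hij hjl.symm,
      hww l i k j hil.symm hkl.symm hjl.symm hik hij hjk.symm,
      htr l k i, htr l k j] at a
    linarith
  -- With T_j = Re⟪v_j, t_ikl⟫, symmetric in i, k, l, `h4` gives T_i + T_j. The total T_i + T_j +
  -- T_k + T_l arises from each of the three pairings of the indices. If A, B, C are the three
  -- products of `κ`, comparison gives B - C = C - A = A - B; these add to zero, so A = B = C.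
  have h6 : ∀ i j k l, i ≠ j → i ≠ k → i ≠ l → j ≠ k → j ≠ l → k ≠ l →
      κ i j * κ k l = κ i k * κ l j ∧ κ i j * κ k l = κ i l * κ j k := by
    intro i j k l hij hik hil hjk hjl hkl
    have a1 := h4 i j k l hij hik hil hjk hjl hkl
    have a2 := h4 k l i j hkl hik.symm hjk.symm hil.symm hjl.symm hij
    have a3 := h4 i k j l hik hij hil hjk.symm hkl hjl
    have a4 := h4 j l i k hjl hij.symm hjk hil.symm hkl.symm hik
    have a5 := h4 i l k j hil hik hij hkl.symm hjl.symm hjk.symm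
    have a6 := h4 j k i l hjk hij.symm hjl hik.symm hkl hil
    simp only [hkA j i, hkA k i, hkA k j, hkA l j, hkA l k, ht k j l, htr l k j,
      ht k i l, htc l i k, ht k i j, htc j i k, htc l i j, ht j i l] at a1 a2 a3 a4 a5 a6 ⊢
    constructor <;> linarith
  set J : ι → ι → ℝ := fun i j ↦ ‖v i‖⁻¹ * ‖v j‖⁻¹ * κ i j with hJ
  refine not_orthogonal_of_mul_eq_mul h5 J (fun i j ↦ ?_) (fun i j ↦ ?_) ?_
  · simp only [hJ]; rw [hkA i j]; ring
  -- Multiplication by `I` turns real parts into imaginary parts, so Parseval for `I • e i` and `I •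
  -- e j` is the orthogonality of the rows of `J`.
  · have := hP (Complex.I • e i) (Complex.I • e j)
    rw [inner_smul_left, inner_smul_right, ← mul_assoc] at this
    simp only [Complex.conj_I, neg_mul, Complex.I_mul_I, neg_neg, one_mul, hon] at this
    rw [← this]
    refine Finset.sum_congr rfl fun l _ ↦ ?_
    simp only [hJ, hk, he, inner_smul_left, inner_smul_right, Complex.conj_ofReal, Complex.conj_I]
    simp
    rw [him (v j)]
    ring
  · intro i j k l hij hik hil hjk hjl hkl
    obtain ⟨a, b⟩ := h6 i j k l hij hik hil hjk hjl hkl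
    simp only [hJ]
    constructor
    -- Each product contains every index once, so normalising the frame multiplies all three by the
    -- same factor.
    · linear_combination (‖v i‖⁻¹ * ‖v j‖⁻¹ * ‖v k‖⁻¹ * ‖v l‖⁻¹) * a
    · linear_combination (‖v i‖⁻¹ * ‖v j‖⁻¹ * ‖v k‖⁻¹ * ‖v l‖⁻¹) * b

end Pointwise

/-! ### From a diagonal metric in an affine chart to the jet relations -/

section Affine

variable {E V : Type*} [NormedAddCommGroup E] [NormedSpace ℝ E] [NormedAddCommGroup V]
  [InnerProductSpace ℂ V] [NormedSpace ℝ V] [IsScalarTower ℝ ℂ V] [FiniteDimensional ℂ V]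
  {ι : Type*} [Fintype ι] [DecidableEq ι]

/-- There are no orthogonal coordinates for the Fubini–Study metric in an affine chart. -/
lemma not_orthogonal_affine (hι : Fintype.card ι = 2 * Module.finrank ℂ V)
    (h5 : 5 ≤ Fintype.card ι) {U : Set E} (hU : IsOpen U) {f : E → V} (hf : SmoothOn U f) {x : E}
    (hx : x ∈ U) (hfx : f x = 0) (a : ι → E) (ha : ∀ i, dirDeriv (a i) f x ≠ 0)
    (h : ∀ y ∈ U, ∀ i j, i ≠ j → (affineHerm f (a i) (a j) y).re = 0) : False := by
  refine not_orthogonal_jet hι h5 (fun i ↦ dirDeriv (a i) f x)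
    (fun i j ↦ dirDeriv (a i) (dirDeriv (a j) f) x)
    (fun i j k ↦ dirDeriv (a i) (dirDeriv (a j) (dirDeriv (a k) f)) x)
    (fun i j ↦ dirDeriv_comm hf _ _ hx) (fun i j k ↦ dirDeriv_comm (hf.dirDeriv _) _ _ hx)
    (fun i j k ↦ dirDeriv_congr hU (dirDeriv_comm hf _ _) _ hx) ha (fun i j hij ↦ ?_)
    (fun i j k hij ↦ ?_) (fun i j k l hij ↦ ?_)
  · simpa [affineHerm, hfx, hermL_apply] using h x hx i j hij
  · rw [← dirDeriv_affineHerm hf hx hfx]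
    exact re_dirDeriv_eq_zero hU (hf.affineHerm _ _) (fun y hy ↦ h y hy i j hij) _ x hx
  · rw [← dirDeriv_dirDeriv_affineHerm hU hf hx hfx]
    exact re_dirDeriv_eq_zero hU ((hf.affineHerm _ _).dirDeriv _) (re_dirDeriv_eq_zero hU
      (hf.affineHerm _ _) (fun y hy ↦ h y hy i j hij) _) _ x hx

end Affine

/-! ### Normalising the homogeneous lift -/

section Homogeneous

variable {m : ℕ} {E : Type*} [NormedAddCommGroup E] [NormedSpace ℝ E]

/-- The Fubini–Study form at `z + v`, on vectors orthogonal to the unit vector `z`. -/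
lemma fsForm_add_of_inner_eq_zero {z v ξ η : Homog m} (hz : ‖z‖ = 1) (hv : inner ℂ z v = 0)
    (hξ : inner ℂ z ξ = 0) (hη : inner ℂ z η = 0) :
    (1 + ‖v‖ ^ 2) ^ 2 * fsForm (z + v) ξ η =
      (inner ℂ ξ η + (inner ℂ v v * inner ℂ ξ η + -(inner ℂ ξ v * inner ℂ v η))).re := by
  have hN : ‖z + v‖ ^ 2 = 1 + ‖v‖ ^ 2 := by
    have := norm_add_sq (𝕜 := ℂ) z v
    rw [hv, hz] at this
    simpa using this
  have hN2 : (‖z + v‖ : ℂ) ^ 2 = 1 + (‖v‖ : ℂ) ^ 2 := by exact_mod_cast congrArg Complex.ofReal hN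
  have hN4 : (‖z + v‖ : ℂ) ^ 4 = (1 + (‖v‖ : ℂ) ^ 2) ^ 2 := by rw [← hN2]; ring
  have hne : (1 + (‖v‖ : ℂ) ^ 2) ≠ 0 := by
    have : (1 + ‖v‖ ^ 2 : ℝ) ≠ 0 := by positivity
    exact_mod_cast this
  have hξ' : inner ℂ ξ z = 0 := inner_eq_zero_symm.1 hξ
  rw [fsForm_apply, ← Complex.re_ofReal_mul, hN2, hN4, inner_add_right, inner_add_left, hξ', hη,
    inner_self_eq_norm_sq_to_K]
  congr 1
  push_cast
  simp only [Complex.coe_algebraMap]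
  field_simp
  ring

/-- The coordinates are only real-differentiable, so the orthogonal projection onto a complex
subspace is needed as a real-linear map. -/
lemma exists_real_projection (W : Submodule ℂ (Homog m)) : ∃ P : Homog m →L[ℝ] W,
    (∀ v ∈ W, (P v : Homog m) = v) ∧ ∀ v, (∀ u ∈ W, inner ℂ u v = 0) → P v = 0 :=
  ⟨W.orthogonalProjectionOnto.restrictScalars ℝ, fun v hv ↦
    congrArg Subtype.val (W.orthogonalProjectionOnto_mem_subspace_eq_self ⟨v, hv⟩), fun v hv ↦
    W.orthogonalProjectionOnto_apply_of_mem_orthogonal ((W.mem_orthogonal v).2 hv)⟩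

/-- There is no map to the affine hyperplane `⟪z, w⟫ = 1` for which the pull-back of the
Fubini–Study form is diagonal and nondegenerate. -/
lemma not_orthogonal_normalized (hm : 3 ≤ m) {U : Set E} (hU : IsOpen U) {G : E → Homog m}
    (hGS : SmoothOn U G) {z : Homog m} (hz1 : ‖z‖ = 1)
    (hGz : ∀ y ∈ U, inner ℂ z (G y) = (1 : ℂ)) {x : E} (hx : x ∈ U) (hGx : G x = z)
    (a : Fin (2 * m) → E)
    (ha : ∀ i, fsForm (G x) (dirDeriv (a i) G x) (dirDeriv (a i) G x) ≠ 0)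
    (h : ∀ y ∈ U, ∀ i j, i ≠ j →
      fsForm (G y) (dirDeriv (a i) G y) (dirDeriv (a j) G y) = 0) : False := by
  have hz0 : z ≠ 0 := norm_ne_zero_iff.1 (by rw [hz1]; exact one_ne_zero)
  have hzz : inner ℂ z z = (1 : ℂ) := by rw [inner_self_eq_norm_sq_to_K, hz1]; simp
  obtain ⟨W, hW⟩ : ∃ W : Submodule ℂ (Homog m), W = (ℂ ∙ z)ᗮ := ⟨_, rfl⟩
  have hWmem : ∀ v, v ∈ W ↔ inner ℂ z v = 0 := fun v ↦ by
    rw [hW]; exact Submodule.mem_orthogonal_singleton_iff_inner_right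
  have hfin : Module.finrank ℂ W = m := by
    have : Fact (Module.finrank ℂ (Homog m) = m + 1) := ⟨by simp⟩
    rw [hW]; exact Submodule.finrank_orthogonal_span_singleton hz0
  obtain ⟨P, hPmem, hPz⟩ := exists_real_projection W
  replace hPz : P z = 0 := hPz z fun u hu ↦ inner_eq_zero_symm.1 ((hWmem u).1 hu)
  obtain ⟨f, hf⟩ : ∃ f : E → W, f = fun y ↦ P (G y) := ⟨_, rfl⟩
  have hfS : SmoothOn U f := fun y hy ↦ hf ▸ P.contDiff.contDiffAt.comp y (hGS y hy)
  have hGf : ∀ y ∈ U, G y = z + f y := by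
    intro y hy
    have : (P (G y - z) : Homog m) = G y - z := hPmem _ (by
      rw [hWmem, inner_sub_right, hGz y hy, hzz, sub_self])
    rw [map_sub, hPz, sub_zero] at this
    rw [hf, this]; abel
  -- Differentiate the constraint ⟪z, G⟫ = 1; thus the derivatives of `G` lie in `W` and agree with
  -- those of `f`.
  have hdz : ∀ y ∈ U, ∀ b, inner ℂ z (dirDeriv b G y) = (0 : ℂ) := by
    intro y hy b
    have h1 : Set.EqOn (fun y ↦ hermL z (G y)) (fun _ ↦ 1) U := hGz
    have h2 := dirDeriv_congr hU h1 b hy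
    rw [dirDeriv_clm (hermL z) hGS b hy, dirDeriv_const] at h2
    exact h2
  have hdf : ∀ y ∈ U, ∀ b, ((dirDeriv b f y : W) : Homog m) = dirDeriv b G y := by
    intro y hy b
    rw [hf, dirDeriv_clm P hGS b hy]
    exact hPmem _ ((hWmem _).2 (hdz y hy b))
  -- The factor (1 + ‖f‖²)² clears the denominators. It does not affect the vanishing of
  -- off-diagonal entries, and it equals 1 at `x`.
  have key : ∀ y ∈ U, ∀ b c, (affineHerm f b c y).re =
      (1 + ‖f y‖ ^ 2) ^ 2 * fsForm (G y) (dirDeriv b G y) (dirDeriv c G y) := by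
    intro y hy b c
    rw [hGf y hy, ← hdf y hy, ← hdf y hy]
    exact (fsForm_add_of_inner_eq_zero hz1 ((hWmem _).1 (f y).2)
      ((hWmem _).1 (dirDeriv b f y).2) ((hWmem _).1 (dirDeriv c f y).2)).symm
  have hfx : f x = 0 := by rw [hf]; simp only [hGx, hPz]
  -- The condition m ≥ 3 enters here, giving 2m ≥ 6 ≥ 5; for m = 2 there are only four indices.
  refine not_orthogonal_affine (V := W) (ι := Fin (2 * m)) (by simp [hfin]) (by simp; omega) hU
    hfS hx hfx a (fun i hi ↦ ha i ?_) (fun y hy i j hij ↦ ?_)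
  · have := key x hx (a i) (a i)
    rw [hfx] at this
    simpa [affineHerm, hi] using this.symm
  · rw [key y hy, h y hy i j hij, mul_zero]

/-- There is no map to `ℂᵐ⁺¹ \ {0}` for which the pull-back of the Fubini–Study form is diagonal
and nondegenerate. -/
lemma not_orthogonal_homogeneous (hm : 3 ≤ m) {U : Set E} (hU : IsOpen U) {F : E → Homog m}
    (hF : SmoothOn U F) (hF0 : ∀ y ∈ U, F y ≠ 0) {x : E} (hx : x ∈ U) (a : Fin (2 * m) → E)
    (ha : ∀ i, fsForm (F x) (dirDeriv (a i) F x) (dirDeriv (a i) F x) ≠ 0)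
    (h : ∀ y ∈ U, ∀ i j, i ≠ j →
      fsForm (F y) (dirDeriv (a i) F y) (dirDeriv (a j) F y) = 0) : False := by
  have hx0 : ‖F x‖ ≠ 0 := norm_ne_zero_iff.2 (hF0 x hx)
  -- Taking `z` along `F x` centres the affine chart at the base point, so that `f` vanishes there.
  set z : Homog m := ((‖F x‖⁻¹ : ℝ) : ℂ) • F x with hz
  have hz1 : ‖z‖ = 1 := by
    rw [hz, norm_smul, Complex.norm_real, norm_inv, norm_norm, inv_mul_cancel₀ hx0]
  have hN : SmoothOn U (fun y ↦ inner ℂ z (F y)) := fun y hy ↦ contDiffAt_const.inner ℂ (hF y hy)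
  set U' : Set E := U ∩ {y | inner ℂ z (F y) ≠ 0}
  have hcont : ContinuousOn (fun y ↦ inner ℂ z (F y)) U := fun y hy ↦
    (hN y hy).continuousAt.continuousWithinAt
  have hU'o : IsOpen U' := hcont.isOpen_inter_preimage hU isOpen_ne
  have hNx : inner ℂ z (F x) = (‖F x‖ : ℂ) := by
    rw [hz, inner_smul_left, inner_self_eq_norm_sq_to_K]
    have : (‖F x‖ : ℂ) ≠ 0 := by exact_mod_cast hx0
    simp only [Complex.conj_ofReal, Complex.coe_algebraMap]
    push_cast
    field_simp
  have hxU' : x ∈ U' := ⟨hx, by simp [hNx, hF0 x hx]⟩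
  -- Rescaling by this factor moves the lift into the hyperplane ⟪z, w⟫ = 1. The extra derivative
  -- terms are multiples of `F y`, which `fsForm` ignores.
  set lam : E → ℂ := fun y ↦ (inner ℂ z (F y))⁻¹ with hlam
  have hlamS : SmoothOn U' lam := fun y hy ↦ (hN y hy.1).inv hy.2
  set G : E → Homog m := fun y ↦ lam y • F y with hG
  have hGS : SmoothOn U' G := fun y hy ↦ (hlamS y hy).smul (hF y hy.1)
  have hGz : ∀ y ∈ U', inner ℂ z (G y) = (1 : ℂ) := fun y hy ↦ by
    rw [hG, inner_smul_right, hlam]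
    exact inv_mul_cancel₀ hy.2
  have hGx : G x = z := by
    simp only [hG, hlam, hNx]
    rw [hz, Complex.ofReal_inv]
  have hGd : ∀ y ∈ U', ∀ b, dirDeriv b G y = lam y • dirDeriv b F y + dirDeriv b lam y • F y := by
    intro y hy b
    have hd : HasFDerivAt G _ y :=
      (hlamS.differentiableAt hy).hasFDerivAt.smul
        (hF.differentiableAt hy.1).hasFDerivAt
    exact congrArg (fun T ↦ T b) hd.fderiv
  have hfs : ∀ y ∈ U', ∀ b c, fsForm (G y) (dirDeriv b G y) (dirDeriv c G y) =
      fsForm (F y) (dirDeriv b F y) (dirDeriv c F y) := by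
    intro y hy b c
    rw [hGd y hy, hGd y hy]
    exact fsForm_smul_add (hF0 y hy.1) (inv_ne_zero hy.2) _ _ _ _
  refine not_orthogonal_normalized hm hU'o hGS hz1 hGz hxU' hGx a (fun i ↦ ?_)
    (fun y hy i j hij ↦ ?_)
  · rw [hfs x hxU']; exact ha i
  · rw [hfs y hy]; exact h y hy.1 i j hij

end Homogeneous

/-! ### Local coordinates on projective space and their lifts -/

section Manifold

variable {m n : ℕ}

/-- A local parametrization of `ℂℙᵐ`, lifted to homogeneous coordinates by the affine chart `i`. -/
noncomputable def LocalCoordinates.lift (x : LocalCoordinates (Fin m → ℂ) (CP m) n) (i : Fin (m + 1))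
    (y : EuclideanSpace ℝ (Fin n)) : Homog m :=
  insertOne i (affineChart i (x.symm y))

/-- The part of the coordinate range that corresponds to the affine chart `i`. -/
def LocalCoordinates.liftDomain (x : LocalCoordinates (Fin m → ℂ) (CP m) n) (i : Fin (m + 1)) :
    Set (EuclideanSpace ℝ (Fin n)) :=
  x.target ∩ x.symm ⁻¹' (affineChart i).source

variable (x : LocalCoordinates (Fin m → ℂ) (CP m) n) {i : Fin (m + 1)}

lemma LocalCoordinates.isOpen_liftDomain : IsOpen (x.liftDomain i) :=
  x.toOpenPartialHomeomorph.symm.isOpen_inter_preimage (affineChart i).open_source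

lemma LocalCoordinates.contDiffAt_affineChart_symm {y : EuclideanSpace ℝ (Fin n)}
    (hy : y ∈ x.liftDomain i) : ContDiffAt ℝ ∞ (fun y ↦ affineChart i (x.symm y)) y := by
  have h1 : ContMDiffAt 𝓘(ℝ, EuclideanSpace ℝ (Fin n)) 𝓘(ℝ, Fin m → ℂ) ∞ x.symm y :=
    (x.symm.contMDiffOn y hy.1).contMDiffAt (x.open_target.mem_nhds hy.1)
  have h2 : ContMDiffAt 𝓘(ℝ, Fin m → ℂ) 𝓘(ℝ, Fin m → ℂ) ∞ (affineChart i) (x.symm y) :=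
    contMDiffAt_of_mem_maximalAtlas
      (IsManifold.subset_maximalAtlas (Set.mem_range_self i)) hy.2
  exact (h2.comp y h1).contDiffAt

lemma LocalCoordinates.smoothOn_lift : SmoothOn (x.liftDomain i) (x.lift i) := fun y hy ↦
  (contDiff_insertOne i).contDiffAt.comp y (x.contDiffAt_affineChart_symm hy)

/-- The manifold derivative is read in the preferred chart at `x.symm (x q)`, which has to be
rewritten to the one at `q`. -/
lemma LocalCoordinates.partialAt_eq_fderiv (k : Fin n) {q : CP m} (hq : q ∈ x.source) :
    (x.partialAt k q : Fin m → ℂ) = fderiv ℝ (fun y ↦ affineChart (chartIdx q) (x.symm y)) (x q)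
      (EuclideanSpace.single k 1) := by
  have hx : x.symm (x q) = q := x.left_inv hq
  have hm : MDifferentiableAt 𝓘(ℝ, EuclideanSpace ℝ (Fin n)) 𝓘(ℝ, Fin m → ℂ) x.symm (x q) :=
    x.symm.mdifferentiableAt (by simp) (x.map_source hq)
  have h1 : (x.partialAt k q : Fin m → ℂ) =
      fderiv ℝ (fun y ↦ affineChart (chartIdx (x.symm (x q))) (x.symm y)) (x q)
        (EuclideanSpace.single k 1) := by
    unfold LocalCoordinates.partialAt
    rw [hm.mfderiv]
    simp only [modelWithCornersSelf_coe, Set.range_id, fderivWithin_univ]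
    rfl
  rw [h1, hx]

lemma LocalCoordinates.partialAt_ne_zero (k : Fin n) {q : CP m} (hq : q ∈ x.source) :
    x.partialAt k q ≠ 0 := by
  intro h0
  have hl := x.symm.isLocalDiffeomorphAt _ _ _ (x := x q) (x.map_source hq)
  have h1 : (EuclideanSpace.single k 1 : EuclideanSpace ℝ (Fin n)) = 0 :=
    (hl.mfderivToContinuousLinearEquiv (by simp)).map_eq_zero_iff.1 h0
  simp at h1

/-- The metric at `q` is defined through the chart preferred at `q`, which may jump with `q`;
differentiating needs one fixed chart `i`. The two expressions agree because `fsForm` depends only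
on the projections of the vectors to projective space. -/
lemma LocalCoordinates.fubiniStudyInner_partialAt (c : ℝ) {q : CP m} (hq : q ∈ x.source)
    (hqi : q ∈ (affineChart i).source) (k l : Fin n) :
    fubiniStudyInner c q (x.partialAt k q) (x.partialAt l q) =
      4 / c * fsForm (x.lift i (x q))
        (dirDeriv (EuclideanSpace.single k 1) (x.lift i) (x q))
        (dirDeriv (EuclideanSpace.single l 1) (x.lift i) (x q)) := by
  have hx : x.symm (x q) = q := x.left_inv hq
  set j := chartIdx q with hj
  have hy : x q ∈ x.liftDomain i := ⟨x.map_source hq, by rw [Set.mem_preimage, hx]; exact hqi⟩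
  have hyj : x q ∈ x.liftDomain j :=
    ⟨x.map_source hq, by rw [Set.mem_preimage, hx]; exact mem_chartIdx_source q⟩
  have hlift : ∀ y ∈ x.liftDomain i,
      x.symm y = Projectivization.mk ℂ (x.lift i y) (insertOne_ne_zero _ _) := fun y hy ↦
    ((affineChart i).left_inv hy.2).symm
  have hcoord : ∀ y ∈ x.liftDomain i, affineChart j (x.symm y) = affineCoord j (x.lift i y) := by
    intro y hy
    rw [hlift y hy]
    exact affineChart_mk j _ _
  have hzj : x.lift i (x q) j ≠ 0 := by
    have := hyj.2
    rw [Set.mem_preimage, hlift _ hy] at this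
    exact this
  have hd : ∀ k, (x.partialAt k q : Fin m → ℂ) = fderiv ℝ (affineCoord j) (x.lift i (x q))
      (dirDeriv (EuclideanSpace.single k 1) (x.lift i) (x q)) := by
    intro k
    rw [x.partialAt_eq_fderiv k hq, ← hj]
    have he : (fun y ↦ affineChart j (x.symm y)) =ᶠ[𝓝 (x q)]
        fun y ↦ affineCoord j (x.lift i y) := by
      filter_upwards [x.isOpen_liftDomain.mem_nhds hy] with y hy using hcoord y hy
    have h1 : HasFDerivAt (affineCoord j) _ (x.lift i (x q)) :=
      ((contDiffAt_affineCoord (n := 1) j hzj).differentiableAt one_ne_zero).hasFDerivAt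
    have h2 := h1.comp (x q) (x.smoothOn_lift.differentiableAt hy).hasFDerivAt
    rw [he.fderiv_eq]
    exact congrArg (fun T ↦ T (EuclideanSpace.single k 1)) h2.fderiv
  have hp : affineChart j q = affineCoord j (x.lift i (x q)) := by
    rw [← hcoord _ hy, hx]
  have h3 := fubiniStudyInner_apply c q (x.partialAt k q) (x.partialAt l q)
  rw [h3, ← hj, hp, hd k, hd l, fsForm_fderiv_affineCoord j hzj]

end Manifold

end OrthCoord

/-- For `m ≥ 3`, `ℂℙᵐ` with the Fubini–Study metric (of any constant holomorphic sectional
curvature `c > 0`) carries no system of orthogonal coordinates on any nonempty open subset. -/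
theorem proposition3p1 (m : ℕ) (hm : 3 ≤ m) (c : ℝ) (hc : 0 < c) :
    ¬ ∃ x : OrthCoord.LocalCoordinates (Fin m → ℂ) (OrthCoord.CP m) (2 * m),
      x.source.Nonempty ∧ OrthCoord.IsOrthogonal (OrthCoord.fubiniStudy m c hc) x := by
  rintro ⟨x, ⟨p, hp⟩, ho⟩
  have hpx : x.symm (x p) = p := x.left_inv hp
  have hpi := OrthCoord.mem_chartIdx_source p
  refine OrthCoord.not_orthogonal_homogeneous hm x.isOpen_liftDomain
    (x.smoothOn_lift (i := OrthCoord.chartIdx p)) (fun y _ ↦ OrthCoord.insertOne_ne_zero _ _)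
    (x := x p) ⟨x.map_source hp, ?_⟩ (fun k ↦ EuclideanSpace.single k 1) (fun k hk ↦ ?_)
    (fun y hy k l hkl ↦ ?_)
  · rw [Set.mem_preimage, hpx]; exact hpi
  -- Nondegeneracy on the diagonal: the metric is positive and coordinate fields of a diffeomorphism
  -- do not vanish.
  · have h1 := x.fubiniStudyInner_partialAt c hp hpi k k
    rw [hk, mul_zero] at h1
    exact ((OrthCoord.fubiniStudy m c hc).pos p _ (x.partialAt_ne_zero k hp)).ne' h1
  · have hq : x.symm y ∈ x.source := x.map_target hy.1
    have hxy : x (x.symm y) = y := x.right_inv hy.1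
    have h1 := x.fubiniStudyInner_partialAt c hq hy.2 k l
    rw [hxy] at h1
    have h2 : OrthCoord.fubiniStudyInner c (x.symm y) (x.partialAt k (x.symm y))
      (x.partialAt l (x.symm y)) = 0 := ho _ hq k l hkl
    rw [h2] at h1
    exact (mul_eq_zero.1 h1.symm).resolve_left (by positivity)
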